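/- Let $p\geq 5$ be a prime number, let $\mathbb{F}_q$ be a finite field of characteristic $p$, let $A=\mathbb{F}_q[T]$, and let $r$ be a prime number. Let $\mathfrak{l}$ be a nonzero prime ideal of $A$ (a finite place of $F=\mathbb{F}_q(T)$), let $A_{\mathfrak{l}}=\varprojlim_n A/\mathfrak{l}^n$ be the completion of $A$ at $\mathfrak{l}$, and let $\mathbb{F}_{\mathfrak{l}}=A/\mathfrak{l}$. Then $\mathrm{SL}_r(A_{\mathfrak{l}})$ is equal to its commutator subgroup. Moreover, the subgroup $$N:=\left\{B\in \mathrm{SL}_r(A_{\mathfrak{l}}) \;\middle|\; B\equiv \delta\cdot I_r \bmod \mathfrak{l} \text{ for some } \delta\in\mathbb{F}_{\mathfrak{l}} \text{ with } \delta^r=1\right\}$$ is normal in $\mathrm{SL}_r(A_{\mathfrak{l}})$ with simple quotient $\mathrm{SL}_r(A_{\mathfrak{l}})/N$, and it is the only normal subgroup of $\mathrm{SL}_r(A_{\mathfrak{l}})$ with simple quotient. -/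

import Mathlib

open Polynomial IsDedekindDomain

/-- `A_𝔩`: the completion of `A = k[T]` at the nonzero prime ideal `𝔩`, i.e. `lim A / 𝔩 ^ n`. -/
abbrev CompletionAt {k : Type*} [Field k] (𝔩 : HeightOneSpectrum k[X]) : Type _ :=
  AdicCompletion 𝔩.asIdeal k[X]

/-- The residue field `𝔽_𝔩 = A / 𝔩`. -/
abbrev ResidueFieldAt {k : Type*} [Field k] (𝔩 : HeightOneSpectrum k[X]) : Type _ :=
  k[X] ⧸ 𝔩.asIdeal

/-- Reduction modulo `𝔩`, from `A_𝔩` to `𝔽_𝔩`. -/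
noncomputable def redMod {k : Type*} [Field k] (𝔩 : HeightOneSpectrum k[X]) :
    CompletionAt 𝔩 →+* ResidueFieldAt 𝔩 :=
  (AdicCompletion.evalOneₐ 𝔩.asIdeal).toRingHom

/-- The subgroup of those `B ∈ SL_r(A_𝔩)` with `B ≡ δ • I_r` modulo `𝔩` for some
`δ ∈ 𝔽_𝔩` with `δ ^ r = 1`. -/
def scalarModSubgroup {k : Type*} [Field k] (r : ℕ) (𝔩 : HeightOneSpectrum k[X]) :
    Subgroup (Matrix.SpecialLinearGroup (Fin r) (CompletionAt 𝔩)) where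
  carrier := {B | ∃ δ : ResidueFieldAt 𝔩, δ ^ r = 1 ∧
    (B : Matrix (Fin r) (Fin r) (CompletionAt 𝔩)).map (redMod 𝔩) =
      δ • (1 : Matrix (Fin r) (Fin r) (ResidueFieldAt 𝔩))}
  one_mem' := ⟨1, one_pow r, by simp⟩
  mul_mem' := by
    rintro B C ⟨δ, hδ, hB⟩ ⟨ε, hε, hC⟩
    refine ⟨δ * ε, by rw [mul_pow, hδ, hε, one_mul], ?_⟩
    rw [Matrix.SpecialLinearGroup.coe_mul, Matrix.map_mul, hB, hC]
    simp [smul_smul, mul_comm]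
  inv_mem' := by
    rintro B ⟨δ, hδ, hB⟩
    rcases r with _ | n
    · exact ⟨1, by simp, Subsingleton.elim _ _⟩
    have hu : δ ^ n * δ = 1 := by rw [← pow_succ, hδ]
    refine ⟨δ ^ n, by rw [← pow_mul, mul_comm, pow_mul, hδ, one_pow], ?_⟩
    have h1 : ((B⁻¹ * B : Matrix.SpecialLinearGroup (Fin (n + 1)) (CompletionAt 𝔩)) :
        Matrix (Fin (n + 1)) (Fin (n + 1)) (CompletionAt 𝔩)).map (redMod 𝔩) = 1 := by
      simp
    rw [Matrix.SpecialLinearGroup.coe_mul, Matrix.map_mul, hB, Matrix.mul_smul, mul_one] at h1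
    rw [← h1, smul_smul, hu, one_smul]

/-!
Let `f : R → F` be a local homomorphism to a field, and let `H` be a normal subgroup of
`SL n R` whose image under `f` is not made of scalars. After a conjugation, some `h ∈ H` has an
off-diagonal entry `h i j` with nonzero image under `f`, hence a unit; a further conjugation gives
`h eⱼ = c eᵢ` with `c` a unit. The commutator of `h` with `1 + Eⱼᵢ` is then so explicit that with
a third index `k` two more commutators produce all transvections `1 + a Eᵢₖ` of `H`. When `i` and
`j` are the only indices, one obtains instead `(1 - s² a Eᵢⱼ)(1 - a Eⱼᵢ) ∈ H` for every unit `s`,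
and comparing `s = 1` with `s = u`, where `u² - 1` is a unit, isolates the transvections
`1 + a Eᵢⱼ`. Over the local ring `R` transvections generate `SL n R`, so `H = ⊤`. This applies to
the commutator subgroup, and it shows that the preimage of the scalars contains every proper normal
subgroup.
-/

section Group

open scoped commutatorElement

variable {G : Type*} [Group G]

theorem commutatorElement_mem_of_left_mem {H : Subgroup G} [H.Normal] {g : G} (hg : g ∈ H)
    (x : G) : ⁅g, x⁆ ∈ H :=
  Subgroup.commutator_le_left H ⊤ (Subgroup.commutator_mem_commutator hg (Subgroup.mem_top x))

theorem commutatorElement_mem_of_right_mem {H : Subgroup G} [H.Normal] {g : G} (x : G)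
    (hg : g ∈ H) : ⁅x, g⁆ ∈ H :=
  Subgroup.commutator_le_right ⊤ H (Subgroup.commutator_mem_commutator (Subgroup.mem_top x) hg)

theorem isSimpleGroup_quotient_iff {N : Subgroup G} [N.Normal] :
    IsSimpleGroup (G ⧸ N) ↔ N ≠ ⊤ ∧ ∀ H : Subgroup G, H.Normal → N ≤ H → H = N ∨ H = ⊤ := by
  have hsurj := QuotientGroup.mk'_surjective N
  have hker := QuotientGroup.ker_mk' N
  constructor
  · refine fun hsimple ↦ ⟨QuotientGroup.nontrivial_iff.1 hsimple.toNontrivial, fun H hH hle ↦ ?_⟩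
    rw [← Subgroup.comap_map_eq_self (hker.trans_le hle)]
    rcases (hH.map _ hsurj).eq_bot_or_eq_top with h | h
    · exact Or.inl (by rw [h, MonoidHom.comap_bot, hker])
    · exact Or.inr (by rw [h, Subgroup.comap_top])
  · rintro ⟨htop, hmax⟩
    refine { toNontrivial := QuotientGroup.nontrivial_iff.2 htop, eq_bot_or_eq_top_of_normal := ?_ }
    intro H hH
    rw [← Subgroup.map_comap_eq_self_of_surjective hsurj H]
    rcases hmax _ (hH.comap (QuotientGroup.mk' N)) (QuotientGroup.le_comap_mk' N H) with h | h
    · exact Or.inl (by rw [h, QuotientGroup.map_mk'_self])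
    · exact Or.inr (by rw [h, Subgroup.map_top_of_surjective _ hsurj])

theorem normal_and_isSimpleGroup_quotient_iff_eq {N : Subgroup G} (hN : N.Normal) (htop : N ≠ ⊤)
    (hmax : ∀ H : Subgroup G, H.Normal → ¬ H ≤ N → H = ⊤) (N' : Subgroup G) :
    (∃ _ : N'.Normal, IsSimpleGroup (G ⧸ N')) ↔ N' = N := by
  simp only [isSimpleGroup_quotient_iff]
  constructor
  · rintro ⟨hN', htop', hmax'⟩
    have hle : N' ≤ N := not_not.1 fun h ↦ htop' (hmax N' hN' h)
    exact ((hmax' N hN hle).resolve_right htop).symm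
  · rintro rfl
    exact ⟨hN, htop, fun H hH hle ↦ (em (H ≤ N')).imp hle.antisymm' (hmax H hH)⟩

end Group

section SpecialLinear

open Matrix hiding transvection mul_inv_rev
open scoped commutatorElement
open Matrix.SpecialLinearGroup (transvection transvection_add transvection_inv)

variable {n R : Type*} [Fintype n] [DecidableEq n] [CommRing R]

theorem smul_single_one (g : SpecialLinearGroup n R) (j : n) :
    g • (Pi.single j 1 : n → R) = fun i ↦ g i j := by
  rw [Matrix.SpecialLinearGroup.smul_def, smul_eq_mulVec, mulVec_single_one]
  rfl

theorem ext_smul_single_one {g h : SpecialLinearGroup n R}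
    (H : ∀ j, g • (Pi.single j 1 : n → R) = h • Pi.single j 1) : g = h := by
  ext i j
  simpa only [smul_single_one] using congrFun (H j) i

/-- The transvection `x ↦ x + (w ⬝ᵥ x) • v`, that is `1 + v wᵀ`, attached to vectors `v`, `w` with
`w ⬝ᵥ v = 0`. The elementary transvections are those whose `v` and `w` are multiples of standard
basis vectors; unlike these, the present ones are stable under conjugation. -/
def vecTransvection (v w : n → R) (h : w ⬝ᵥ v = 0) : SpecialLinearGroup n R :=
  ⟨1 + vecMulVec v w, by
    rw [vecMulVec_eq Unit, det_one_add_replicateCol_mul_replicateRow, h, add_zero]⟩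

theorem coe_vecTransvection (v w : n → R) (h : w ⬝ᵥ v = 0) :
    (vecTransvection v w h : Matrix n n R) = 1 + vecMulVec v w := rfl

theorem vecTransvection_smul (v w x : n → R) (h : w ⬝ᵥ v = 0) :
    vecTransvection v w h • x = x + (w ⬝ᵥ x) • v := by
  rw [Matrix.SpecialLinearGroup.smul_def, smul_eq_mulVec, coe_vecTransvection, add_mulVec,
    one_mulVec, vecMulVec_mulVec, op_smul_eq_smul]

theorem vecMul_vecTransvection (v w x : n → R) (h : w ⬝ᵥ v = 0) :
    x ᵥ* (vecTransvection v w h : Matrix n n R) = x + (x ⬝ᵥ v) • w := by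
  rw [coe_vecTransvection, vecMul_add, vecMul_one, vecMul_vecMulVec]

theorem vecTransvection_mul (v v' w : n → R) (h : w ⬝ᵥ v = 0) (h' : w ⬝ᵥ v' = 0) :
    vecTransvection v w h * vecTransvection v' w h' =
      vecTransvection (v + v') w (by rw [dotProduct_add, h, h', add_zero]) := by
  refine ext_smul_single_one fun j ↦ ?_
  simp only [mul_smul, vecTransvection_smul, dotProduct_smul, h', smul_zero,
    zero_smul, smul_add]
  abel

theorem vecTransvection_zero (w : n → R) : vecTransvection 0 w (dotProduct_zero w) = 1 := by
  ext; simp [coe_vecTransvection]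

theorem vecTransvection_inv (v w : n → R) (h : w ⬝ᵥ v = 0) :
    (vecTransvection v w h)⁻¹ = vecTransvection (-v) w (by rw [dotProduct_neg, h, neg_zero]) := by
  rw [inv_eq_iff_mul_eq_one, vecTransvection_mul]
  simp only [add_neg_cancel, vecTransvection_zero]

theorem transvection_eq_vecTransvection {i j : n} (hij : i ≠ j) (a : R) :
    transvection hij a = vecTransvection (Pi.single i a) (Pi.single j 1) (by simp [hij]) := by
  refine Subtype.ext (congrArg (1 + ·) ?_)
  rw [← mul_one a, ← smul_eq_mul, ← smul_single, single_eq_single_vecMulVec_single,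
    ← smul_vecMulVec, ← Pi.single_smul]

theorem transvection_smul {i j : n} (hij : i ≠ j) (a : R) (x : n → R) :
    transvection hij a • x = x + Pi.single i (a * x j) := by
  rw [transvection_eq_vecTransvection, vecTransvection_smul, single_one_dotProduct,
    ← Pi.single_smul, smul_eq_mul, mul_comm]

theorem vecMul_transvection {i j : n} (hij : i ≠ j) (a : R) (x : n → R) :
    x ᵥ* (transvection hij a : Matrix n n R) = x + Pi.single j (x i * a) := by
  rw [transvection_eq_vecTransvection, vecMul_vecTransvection, dotProduct_single,
    ← Pi.single_smul, smul_eq_mul, mul_one]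

theorem dotProduct_smul_of_vecMul_eq (g : SpecialLinearGroup n R) {v w w' : n → R}
    (hw : w' ᵥ* (g : Matrix n n R) = w) : w' ⬝ᵥ (g • v) = w ⬝ᵥ v := by
  rw [Matrix.SpecialLinearGroup.smul_def, smul_eq_mulVec, dotProduct_mulVec, hw]

theorem conj_vecTransvection (g : SpecialLinearGroup n R) {v w w' : n → R}
    (hw : w' ᵥ* (g : Matrix n n R) = w) (h : w ⬝ᵥ v = 0) :
    g * vecTransvection v w h * g⁻¹ =
      vecTransvection (g • v) w' ((dotProduct_smul_of_vecMul_eq g hw).trans h) := by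
  rw [mul_inv_eq_iff_eq_mul]
  refine ext_smul_single_one fun j ↦ ?_
  simp only [mul_smul, vecTransvection_smul, smul_add, dotProduct_smul_of_vecMul_eq g hw]
  rw [smul_comm]

theorem commutatorElement_vecTransvection (g : SpecialLinearGroup n R) {v w : n → R}
    (hw : w ᵥ* (g : Matrix n n R) = w) (h : w ⬝ᵥ v = 0) :
    ⁅g, vecTransvection v w h⁆ = vecTransvection (g • v - v) w
      (by rw [dotProduct_sub, dotProduct_smul_of_vecMul_eq g hw, sub_self]) := by
  simp only [commutatorElement_def, conj_vecTransvection g hw h, vecTransvection_inv,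
    vecTransvection_mul, sub_eq_add_neg]

theorem commutatorElement_transvection {i j k : n} (hij : i ≠ j) (hjk : j ≠ k) (hik : i ≠ k)
    (a b : R) :
    ⁅transvection hij a, transvection hjk b⁆ = transvection hik (a * b) := by
  have hw : (Pi.single k 1 : n → R) ᵥ* (transvection hij a : Matrix n n R) = Pi.single k 1 := by
    rw [vecMul_transvection, Pi.single_eq_of_ne hik, zero_mul, Pi.single_zero, add_zero]
  rw [transvection_eq_vecTransvection hjk, commutatorElement_vecTransvection _ hw,
    transvection_eq_vecTransvection hik]
  simp only [transvection_smul, Pi.single_eq_same, add_sub_cancel_left]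

theorem conj_transvection_symm {i j : n} (hij : i ≠ j) {s t : R} (hst : s * t = 1) (a : R) :
    (transvection hij.symm (-t) * transvection hij s) * transvection hij.symm a *
      (transvection hij.symm (-t) * transvection hij s)⁻¹ = transvection hij (-(s ^ 2 * a)) := by
  rw [mul_inv_eq_iff_eq_mul]
  refine ext_smul_single_one fun k ↦ funext fun l ↦ ?_
  simp only [mul_smul, transvection_smul, Pi.add_apply, Pi.single_apply]
  grind

theorem conj_transvection_apply {i j : n} (hij : i ≠ j) (a : R) (g : SpecialLinearGroup n R) :
    (transvection hij a * g * (transvection hij a)⁻¹ : SpecialLinearGroup n R) i j =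
      g i j + a * g j j - a * (g i i + a * g j i) := by
  have hinv : (transvection hij a)⁻¹ • (Pi.single j 1 : n → R) =
      Pi.single j 1 - a • Pi.single i 1 := by
    rw [transvection_inv, transvection_smul, Pi.single_eq_same, mul_one, Pi.single_neg,
      ← sub_eq_add_neg, ← Pi.single_smul, smul_eq_mul, mul_one]
  have hcol := congrFun (smul_single_one (transvection hij a * g * (transvection hij a)⁻¹) j) i
  rw [← hcol, mul_smul, hinv, mul_smul, smul_sub, smul_comm g, smul_single_one, smul_single_one,
    transvection_smul]
  simp only [Pi.add_apply, Pi.sub_apply, Pi.smul_apply, Pi.single_eq_same, smul_eq_mul]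
  ring

/-! ### Generation by elementary transvections over a local ring -/

section Generation

variable {K : Subgroup (SpecialLinearGroup n R)}

theorem vecTransvection_single_one_mem
    (hK : ∀ (i j : n) (hij : i ≠ j) (a : R), transvection hij a ∈ K) {j : n} (v : n → R)
    (hv : Pi.single j 1 ⬝ᵥ v = 0) : vecTransvection v (Pi.single j 1) hv ∈ K := by
  have hvj : v j = 0 := by rwa [single_one_dotProduct] at hv
  suffices ∃ h, vecTransvection (∑ i, Pi.single i (v i)) (Pi.single j 1) h ∈ K by
    simpa only [Finset.univ_sum_single, hv, exists_true_left] using this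
  refine Finset.sum_induction _ (fun u ↦ ∃ h, vecTransvection u (Pi.single j 1) h ∈ K) ?_ ?_ ?_
  · rintro u u' ⟨h, hu⟩ ⟨h', hu'⟩
    exact ⟨_, vecTransvection_mul u u' _ h h' ▸ mul_mem hu hu'⟩
  · exact ⟨_, vecTransvection_zero (Pi.single j (1 : R)) ▸ one_mem K⟩
  · intro i _
    rcases eq_or_ne i j with rfl | hij
    · rw [hvj, Pi.single_zero]
      exact ⟨_, vecTransvection_zero (Pi.single i (1 : R)) ▸ one_mem K⟩
    · exact ⟨_, transvection_eq_vecTransvection hij (v i) ▸ hK i j hij (v i)⟩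

/-- The matrices whose columns indexed by `S` are those of the identity matrix. Enlarging `S` one
index at a time is the induction by which matrices are reduced to products of transvections. -/
def columnFixer (R : Type*) [CommRing R] (S : Finset n) : Subgroup (SpecialLinearGroup n R) :=
  fixingSubgroup _ ((Pi.single · (1 : R)) '' (S : Set n))

theorem mem_columnFixer {S : Finset n} {g : SpecialLinearGroup n R} :
    g ∈ columnFixer R S ↔ ∀ s ∈ S, g • (Pi.single s 1 : n → R) = Pi.single s 1 := by
  simp only [columnFixer, mem_fixingSubgroup_iff, Set.forall_mem_image, Finset.mem_coe]

theorem columnFixer_univ : columnFixer R (Finset.univ : Finset n) = ⊥ :=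
  (Subgroup.eq_bot_iff_forall _).2 fun _ hg ↦ ext_smul_single_one fun j ↦
    (mem_columnFixer.1 hg j (Finset.mem_univ j)).trans (one_smul _ _).symm

theorem vecTransvection_mem_columnFixer {S : Finset n} {j : n} (hj : j ∉ S) {v : n → R}
    (h : Pi.single j 1 ⬝ᵥ v = 0) : vecTransvection v (Pi.single j 1) h ∈ columnFixer R S := by
  refine mem_columnFixer.2 fun s hs ↦ ?_
  rw [vecTransvection_smul, single_one_dotProduct,
    Pi.single_eq_of_ne (ne_of_mem_of_not_mem hs hj).symm, zero_smul, add_zero]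

theorem transvection_mem_columnFixer {S : Finset n} {i j : n} (hij : i ≠ j) (hj : j ∉ S) (a : R) :
    transvection hij a ∈ columnFixer R S :=
  transvection_eq_vecTransvection hij a ▸ vecTransvection_mem_columnFixer hj _

theorem exists_smul_eq_single_of_apply_eq_one
    (hK : ∀ (i j : n) (hij : i ≠ j) (a : R), transvection hij a ∈ K) {S : Finset n} {j : n}
    (hj : j ∉ S) {y : n → R} (hy : y j = 1) : ∃ t ∈ K ⊓ columnFixer R S, t • y = Pi.single j 1 := by
  have h : Pi.single j 1 ⬝ᵥ (Pi.single j 1 - y) = 0 := by simp [hy]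
  refine ⟨_, ⟨vecTransvection_single_one_mem hK _ h, vecTransvection_mem_columnFixer hj h⟩, ?_⟩
  rw [vecTransvection_smul, single_one_dotProduct, hy, one_smul, add_sub_cancel]

theorem exists_smul_eq_single_of_isUnit_apply_of_ne
    (hK : ∀ (i j : n) (hij : i ≠ j) (a : R), transvection hij a ∈ K) {S : Finset n} {j k : n}
    (hj : j ∉ S) (hk : k ∉ S) (hjk : j ≠ k) {y : n → R} (hy : IsUnit (y k)) :
    ∃ t ∈ K ⊓ columnFixer R S, t • y = Pi.single j 1 := by
  obtain ⟨b, hb⟩ := hy.exists_left_inv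
  let e := transvection hjk ((1 - y j) * b)
  have he : (e • y) j = 1 := by simp [e, transvection_smul, mul_assoc, hb]
  obtain ⟨t, ht, hty⟩ := exists_smul_eq_single_of_apply_eq_one hK hj he
  exact ⟨t * e, mul_mem ht ⟨hK _ _ _ _, transvection_mem_columnFixer hjk hk _⟩,
    (mul_smul _ _ _).trans hty⟩

theorem exists_smul_eq_single_of_isUnit_apply
    (hK : ∀ (i j : n) (hij : i ≠ j) (a : R), transvection hij a ∈ K) {S : Finset n} {j k : n}
    (hj : j ∉ S) (hk : k ∉ S) (hjk : j ≠ k) {y : n → R} (hy : IsUnit (y j)) :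
    ∃ t ∈ K ⊓ columnFixer R S, t • y = Pi.single j 1 := by
  obtain ⟨b, hb⟩ := hy.exists_left_inv
  let e := transvection hjk.symm ((1 - y k) * b)
  have he : (e • y) k = 1 := by simp [e, transvection_smul, mul_assoc, hb]
  obtain ⟨t, ht, hty⟩ :=
    exists_smul_eq_single_of_isUnit_apply_of_ne hK hj hk hjk (he ▸ isUnit_one)
  exact ⟨t * e, mul_mem ht ⟨hK _ _ _ _, transvection_mem_columnFixer hjk.symm hj _⟩,
    (mul_smul _ _ _).trans hty⟩

theorem apply_self_eq_one_of_mem_columnFixer {S : Finset n} {j : n} (hS : ∀ k, k ∉ S → k = j)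
    {g : SpecialLinearGroup n R} (hg : g ∈ columnFixer R S) : g j j = 1 := by
  have h : (g : Matrix n n R) = (1 : Matrix n n R).updateCol j (fun i ↦ g i j) := by
    ext a b
    rcases eq_or_ne b j with rfl | hb
    · rw [updateCol_self]
    · have hbS : b ∈ S := by_contra fun h ↦ hb (hS b h)
      rw [updateCol_ne hb, one_eq_pi_single, Pi.single_comm]
      simpa only [smul_single_one] using congrFun (mem_columnFixer.1 hg b hbS) a
  have hdet := g.det_coe
  rwa [h, ← cramer_apply, cramer_one] at hdet

theorem exists_isUnit_apply_of_mem_columnFixer [IsLocalRing R] {S : Finset n} {j : n} (hj : j ∉ S)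
    {g : SpecialLinearGroup n R} (hg : g ∈ columnFixer R S) : ∃ i ∉ S, IsUnit (g i j) := by
  by_contra! hcon
  have hsum : ∑ i, g⁻¹ j i * g i j = 1 := by
    rw [← mul_apply, ← Matrix.SpecialLinearGroup.coe_mul, inv_mul_cancel,
      Matrix.SpecialLinearGroup.coe_one, one_apply_eq]
  refine (IsLocalRing.maximalIdeal.isMaximal R).ne_top ((Ideal.eq_top_iff_one _).2 ?_)
  rw [← hsum]
  refine Ideal.sum_mem _ fun i _ ↦ ?_
  by_cases hi : i ∈ S
  · have hji : g⁻¹ j i = 0 := by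
      have h := congrFun (mem_columnFixer.1 (inv_mem hg) i hi) j
      rwa [smul_single_one, Pi.single_eq_of_ne (ne_of_mem_of_not_mem hi hj).symm] at h
    rw [hji, zero_mul]
    exact zero_mem _
  · exact Ideal.mul_mem_left _ _ ((IsLocalRing.mem_maximalIdeal _).2 (hcon i hi))

theorem exists_mul_mem_columnFixer_insert [IsLocalRing R]
    (hK : ∀ (i j : n) (hij : i ≠ j) (a : R), transvection hij a ∈ K) {S : Finset n} {j : n}
    (hj : j ∉ S) {g : SpecialLinearGroup n R} (hg : g ∈ columnFixer R S) :
    ∃ t ∈ K, t * g ∈ columnFixer R (insert j S) := by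
  suffices ∃ t ∈ K ⊓ columnFixer R S, t • (fun i ↦ g i j) = Pi.single j 1 by
    obtain ⟨t, ht, hty⟩ := this
    refine ⟨t, ht.1, mem_columnFixer.2 fun s hs ↦ ?_⟩
    rcases Finset.mem_insert.1 hs with rfl | hs
    · rw [mul_smul, smul_single_one, hty]
    · exact mem_columnFixer.1 (mul_mem ht.2 hg) s hs
  obtain ⟨i, hi, hu⟩ := exists_isUnit_apply_of_mem_columnFixer hj hg
  rcases eq_or_ne j i with rfl | hji
  · by_cases hS : ∀ k, k ∉ S → k = j
    · exact exists_smul_eq_single_of_apply_eq_one hK hj (apply_self_eq_one_of_mem_columnFixer hS hg)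
    · push Not at hS
      obtain ⟨k, hk, hkj⟩ := hS
      exact exists_smul_eq_single_of_isUnit_apply hK hj hk hkj.symm hu
  · exact exists_smul_eq_single_of_isUnit_apply_of_ne hK hj hi hji hu

theorem eq_top_of_transvection_mem [IsLocalRing R]
    (hK : ∀ (i j : n) (hij : i ≠ j) (a : R), transvection hij a ∈ K) : K = ⊤ := by
  refine (Subgroup.eq_top_iff' K).2 fun g ↦ ?_
  have key (S : Finset n) : ∃ t ∈ K, t * g ∈ columnFixer R S := by
    induction S using Finset.induction_on with
    | empty => exact ⟨1, one_mem K, mem_columnFixer.2 fun s hs ↦ absurd hs (Finset.notMem_empty s)⟩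
    | insert j S hj ih =>
      obtain ⟨t, ht, h⟩ := ih
      obtain ⟨t', ht', h'⟩ := exists_mul_mem_columnFixer_insert hK hj h
      exact ⟨t' * t, mul_mem ht' ht, mul_assoc t' t g ▸ h'⟩
  obtain ⟨t, ht, h⟩ := key Finset.univ
  rw [columnFixer_univ, Subgroup.mem_bot] at h
  exact (mul_mem_cancel_left ht).1 (h ▸ one_mem K)

end Generation

/-! ### Normal subgroups containing transvections -/

section Normal

variable {H : Subgroup (SpecialLinearGroup n R)} [H.Normal]

theorem forall_transvection_mem_symm {i j : n} (hij : i ≠ j)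
    (h : ∀ a : R, transvection hij.symm a ∈ H) (a : R) : transvection hij a ∈ H := by
  have hconj := conj_transvection_symm hij (mul_one (1 : R)) (-a)
  rw [one_pow, one_mul, neg_neg] at hconj
  exact hconj ▸ Subgroup.Normal.conj_mem inferInstance _ (h (-a)) _

theorem forall_transvection_mem_of_fst {i j k : n} (hij : i ≠ j) (hkj : k ≠ j)
    (h : ∀ a : R, transvection hij a ∈ H) (a : R) : transvection hkj a ∈ H := by
  rcases eq_or_ne k i with rfl | hki
  · exact h a
  · rw [← one_mul a, ← commutatorElement_transvection hki hij hkj]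
    exact commutatorElement_mem_of_right_mem _ (h a)

theorem forall_transvection_mem_of_snd {i j k : n} (hij : i ≠ j) (hik : i ≠ k)
    (h : ∀ a : R, transvection hij a ∈ H) (a : R) : transvection hik a ∈ H := by
  rcases eq_or_ne j k with rfl | hjk
  · exact h a
  · rw [← mul_one a, ← commutatorElement_transvection hij hjk hik]
    exact commutatorElement_mem_of_left_mem (h a) _

theorem eq_top_of_forall_transvection_mem [IsLocalRing R] {i j : n} (hij : i ≠ j)
    (h : ∀ a : R, transvection hij a ∈ H) : H = ⊤ := by
  refine eq_top_of_transvection_mem fun k l hkl ↦ ?_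
  rcases eq_or_ne k j with rfl | hkj
  · exact forall_transvection_mem_of_snd hij.symm hkl (forall_transvection_mem_symm hij.symm h)
  · exact forall_transvection_mem_of_snd hkj hkl (forall_transvection_mem_of_fst hij hkj h)

theorem exists_mem_smul_single_one_eq {h : SpecialLinearGroup n R} (hh : h ∈ H) {i j : n}
    (hij : i ≠ j) (hu : IsUnit (h i j)) :
    ∃ h' ∈ H, h' • (Pi.single j 1 : n → R) = Pi.single i (h i j) := by
  obtain ⟨b, hb⟩ := hu.exists_right_inv
  let y : n → R := b • (Pi.single i (h i j) - h • (Pi.single j 1 : n → R))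
  have hy : Pi.single i 1 ⬝ᵥ y = 0 := by simp [y, smul_single_one]
  let t := vecTransvection y (Pi.single i 1) hy
  have htj : t⁻¹ • (Pi.single j 1 : n → R) = Pi.single j 1 := by
    rw [inv_smul_eq_iff, vecTransvection_smul, single_one_dotProduct, Pi.single_eq_of_ne hij,
      zero_smul, add_zero]
  refine ⟨t * h * t⁻¹, Subgroup.Normal.conj_mem inferInstance h hh t, ?_⟩
  rw [mul_smul, mul_smul, htj, vecTransvection_smul, single_one_dotProduct, smul_single_one h j,
    smul_smul, hb, one_smul, ← smul_single_one, add_sub_cancel]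

theorem exists_vecMul_eq (g : SpecialLinearGroup n R) (w : n → R) :
    ∃ w', w' ᵥ* (g : Matrix n n R) = w := by
  refine ⟨w ᵥ* (g⁻¹ : SpecialLinearGroup n R).1, ?_⟩
  rw [vecMul_vecMul, ← Matrix.SpecialLinearGroup.coe_mul, inv_mul_cancel,
    Matrix.SpecialLinearGroup.coe_one, vecMul_one]

theorem commutatorElement_transvection_of_smul_single {h : SpecialLinearGroup n R} {i j : n}
    (hij : i ≠ j) {c : R} (hc : h • (Pi.single j 1 : n → R) = Pi.single i c) {w : n → R}
    (hw : w ᵥ* (h : Matrix n n R) = Pi.single i 1) (a : R) :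
    ∃ hwc, ⁅h, transvection hij.symm a⁆ =
      vecTransvection (Pi.single i (c * a)) w hwc * transvection hij.symm (-a) := by
  have hca : h • (Pi.single j a : n → R) = Pi.single i (c * a) := by
    rw [← mul_one a, ← smul_eq_mul, Pi.single_smul, smul_comm, hc, ← Pi.single_smul, smul_eq_mul,
      smul_eq_mul, mul_one, mul_comm]
  refine ⟨hca ▸ (dotProduct_smul_of_vecMul_eq h hw).trans (by simp [hij]), ?_⟩
  rw [commutatorElement_def, ← transvection_inv]
  simp only [transvection_eq_vecTransvection hij.symm a, conj_vecTransvection h hw, hca]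

theorem exists_vecTransvection_mem_of_smul_single {h : SpecialLinearGroup n R} (hh : h ∈ H)
    {i j k : n} (hij : i ≠ j) (hik : i ≠ k) (hjk : j ≠ k) {c : R}
    (hc : h • (Pi.single j 1 : n → R) = Pi.single i c) :
    ∃ (b : R) (hb : _), vecTransvection (Pi.single i b - Pi.single j 1) (Pi.single k 1) hb ∈ H := by
  obtain ⟨w, hw⟩ := exists_vecMul_eq h (Pi.single i 1)
  obtain ⟨hwc, hg⟩ := commutatorElement_transvection_of_smul_single hij hc hw 1
  let g := ⁅h, transvection hij.symm (1 : R)⁆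
  have hgk : Pi.single k 1 ᵥ* (g : Matrix n n R) = Pi.single k 1 := by
    simp only [g, hg, Matrix.SpecialLinearGroup.coe_mul, ← vecMul_vecMul, vecMul_vecTransvection,
      single_one_dotProduct, vecMul_transvection]
    simp [hik.symm, hjk.symm]
  have hgi : ∃ b : R, g • (Pi.single i 1 : n → R) - Pi.single i 1 =
      Pi.single i b - Pi.single j 1 := by
    refine ⟨(w ⬝ᵥ (Pi.single i 1 - Pi.single j 1)) * c, ?_⟩
    simp only [g, hg, mul_smul, transvection_smul, vecTransvection_smul, Pi.single_eq_same, mul_one,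
      Pi.single_neg, ← Pi.single_smul, smul_eq_mul, ← sub_eq_add_neg]
    abel
  obtain ⟨b, hb⟩ := hgi
  have hu := commutatorElement_mem_of_left_mem (commutatorElement_mem_of_left_mem hh
    (transvection hij.symm 1)) (transvection hik 1)
  simp only [transvection_eq_vecTransvection hik, commutatorElement_vecTransvection g hgk, hb,
    g] at hu
  exact ⟨b, _, hu⟩

theorem forall_transvection_mem_of_smul_single_of_ne {h : SpecialLinearGroup n R} (hh : h ∈ H)
    {i j k : n} (hij : i ≠ j) (hik : i ≠ k) (hjk : j ≠ k) {c : R}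
    (hc : h • (Pi.single j 1 : n → R) = Pi.single i c) (a : R) : transvection hik a ∈ H := by
  obtain ⟨b, hb, hu⟩ := exists_vecTransvection_mem_of_smul_single hh hij hik hjk hc
  have hk : Pi.single k 1 ᵥ* (transvection hij (-a) : Matrix n n R) = Pi.single k 1 := by
    rw [vecMul_transvection, Pi.single_eq_of_ne hik, zero_mul, Pi.single_zero, add_zero]
  have hcomm := commutatorElement_mem_of_right_mem (transvection hij (-a)) hu
  simp only [commutatorElement_vecTransvection _ hk, transvection_smul] at hcomm
  simpa [transvection_eq_vecTransvection hik, hij] using hcomm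

theorem transvection_mul_transvection_symm_mem_of_mem {i j : n} (hij : i ≠ j) {s t : R}
    (hs : IsUnit s) (h : transvection hij s * transvection hij.symm t ∈ H) (a : R) :
    transvection hij (-(s ^ 2 * a)) * transvection hij.symm (-a) ∈ H := by
  obtain ⟨s', hs'⟩ := hs.exists_right_inv
  let g := transvection hij.symm (-s') * transvection hij s
  have hg : g * transvection hij.symm (t + s') ∈ H := by
    have hconj := Subgroup.Normal.conj_mem inferInstance _ h (transvection hij.symm (-s'))
    rwa [transvection_inv, neg_neg, mul_assoc, mul_assoc, ← transvection_add, ← mul_assoc] at hconj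
  have hcommute : ⁅transvection hij.symm (t + s'), transvection hij.symm a⁆ = 1 := by
    rw [commutatorElement_eq_one_iff_mul_comm, ← transvection_add, ← transvection_add, add_comm]
  have hcomm : ⁅g * transvection hij.symm (t + s'), transvection hij.symm a⁆ =
      transvection hij (-(s ^ 2 * a)) * transvection hij.symm (-a) := by
    rw [commutatorElement_mul_left_eq_conj_mul, hcommute, mul_one,
      mul_inv_cancel, one_mul, commutatorElement_def,
      conj_transvection_symm hij hs', transvection_inv]
  exact hcomm ▸ commutatorElement_mem_of_left_mem hg _

theorem exists_transvection_mul_transvection_symm_mem {h : SpecialLinearGroup n R} (hh : h ∈ H)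
    {i j : n} (hij : i ≠ j) (htwo : ∀ k, k ≠ i → k = j) {c : R} (hu : IsUnit c)
    (hc : h • (Pi.single j 1 : n → R) = Pi.single i c) :
    ∃ d : R, IsUnit d ∧ ∀ a, transvection hij (d * a) * transvection hij.symm (-a) ∈ H := by
  obtain ⟨w, hw⟩ := exists_vecMul_eq h (Pi.single i 1)
  have hwi : w i = 0 := by
    have hwc := dotProduct_smul_of_vecMul_eq h (v := Pi.single j 1) hw
    rw [hc, dotProduct_single, dotProduct_single, Pi.single_eq_of_ne hij.symm, zero_mul] at hwc
    exact hu.mul_left_eq_zero.1 hwc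
  obtain ⟨b, rfl⟩ : ∃ b : R, w = b • Pi.single j 1 := by
    refine ⟨w j, funext fun k ↦ ?_⟩
    rcases eq_or_ne k i with rfl | hk
    · simp [hwi, hij]
    · simp [htwo k hk]
  have hb : b * h j i = 1 := by
    have hwi := congrFun hw i
    rwa [smul_vecMul, single_one_vecMul, Pi.single_eq_same] at hwi
  refine ⟨c * b, hu.mul (IsUnit.of_mul_eq_one _ hb), fun a ↦ ?_⟩
  have hcomm := commutatorElement_mem_of_left_mem hh (transvection hij.symm a)
  obtain ⟨_, h_eq⟩ := commutatorElement_transvection_of_smul_single hij hc hw a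
  have hT : vecTransvection (Pi.single i (c * a)) (b • Pi.single j 1) (by simp [hij]) =
      transvection hij (c * b * a) := by
    refine ext_smul_single_one fun k ↦ ?_
    rw [vecTransvection_smul, transvection_smul, smul_dotProduct, single_one_dotProduct,
      ← Pi.single_smul]
    simp only [smul_eq_mul]
    ring_nf
  rwa [h_eq, hT] at hcomm

theorem forall_transvection_mem_of_smul_single_of_two {h : SpecialLinearGroup n R} (hh : h ∈ H)
    {i j : n} (hij : i ≠ j) (htwo : ∀ k, k ≠ i → k = j) {u : R} (hu : IsUnit u)
    (hu' : IsUnit (u ^ 2 - 1)) {c : R} (hc : IsUnit c)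
    (hhc : h • (Pi.single j 1 : n → R) = Pi.single i c) (a : R) : transvection hij a ∈ H := by
  obtain ⟨d, hd, hdH⟩ := exists_transvection_mul_transvection_symm_mem hh hij htwo hc hhc
  have key {s : R} (hs : IsUnit s) (x : R) :
      transvection hij (-(s ^ 2 * x)) * transvection hij.symm (-x) ∈ H := by
    obtain ⟨d', hd'⟩ := hd.exists_right_inv
    have hprod := hdH (d' * s)
    rw [← mul_assoc, hd', one_mul] at hprod
    exact transvection_mul_transvection_symm_mem_of_mem hij hs hprod x
  obtain ⟨v, hv⟩ := hu'.exists_right_inv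
  have hquot := H.mul_mem (key isUnit_one (v * a)) (H.inv_mem (key hu (v * a)))
  rw [mul_inv_rev, mul_assoc, mul_inv_cancel_left, transvection_inv, ← transvection_add] at hquot
  convert hquot using 2
  linear_combination -a * hv

theorem eq_top_of_mem_of_isUnit_apply [IsLocalRing R]
    (hR : Fintype.card n = 2 → ∃ u : R, IsUnit u ∧ IsUnit (u ^ 2 - 1))
    {h : SpecialLinearGroup n R} (hh : h ∈ H) {i j : n} (hij : i ≠ j) (hu : IsUnit (h i j)) :
    H = ⊤ := by
  obtain ⟨g, hg, hgj⟩ := exists_mem_smul_single_one_eq hh hij hu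
  by_cases htwo : ∀ k, k ≠ i → k = j
  · have huniv : (Finset.univ : Finset n) = {i, j} := by
      ext k
      simpa [or_iff_not_imp_left] using htwo k
    obtain ⟨u, hu₁, hu₂⟩ := hR (by rw [← Finset.card_univ, huniv, Finset.card_pair hij])
    exact eq_top_of_forall_transvection_mem hij
      (forall_transvection_mem_of_smul_single_of_two hg hij htwo hu₁ hu₂ hu hgj)
  · push Not at htwo
    obtain ⟨k, hki, hkj⟩ := htwo
    exact eq_top_of_forall_transvection_mem hki.symm
      (forall_transvection_mem_of_smul_single_of_ne hg hij hki.symm hkj.symm hgj)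

end Normal

/-! ### Normal subgroups not contained in the scalars -/

section Reduction

theorem exists_apply_self_ne_of_notMem_center {g : SpecialLinearGroup n R}
    (hg : g ∉ Subgroup.center (SpecialLinearGroup n R)) (hdiag : ∀ i j, i ≠ j → g i j = 0) :
    ∃ i j, g i i ≠ g j j := by
  contrapose! hg
  have hdiag' : (g : Matrix n n R) = diagonal fun i ↦ g i i := by
    ext i j
    rcases eq_or_ne i j with rfl | hij
    · rw [diagonal_apply_eq]
    · rw [diagonal_apply_ne _ hij, hdiag i j hij]
  refine Subgroup.mem_center_iff.2 fun x ↦ Subtype.ext ?_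
  ext i j
  rw [Matrix.SpecialLinearGroup.coe_mul, Matrix.SpecialLinearGroup.coe_mul, hdiag', mul_diagonal,
    diagonal_mul, hg i j, mul_comm]

variable {F : Type*} [Field F] (f : R →+* F)

theorem map_apply_eq_zero_of_mem_comap_center {g : SpecialLinearGroup n R}
    (hg : g ∈ (Subgroup.center (SpecialLinearGroup n F)).comap (SpecialLinearGroup.map f))
    {i j : n} (hij : i ≠ j) : f (g i j) = 0 := by
  obtain ⟨c, -, hc⟩ := Matrix.SpecialLinearGroup.mem_center_iff.1 (Subgroup.mem_comap.1 hg)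
  have hentry := congrFun (congrFun hc i) j
  rwa [scalar_apply, diagonal_apply_ne _ hij, eq_comm] at hentry

theorem not_commutator_le_comap_center [Nontrivial n] :
    ¬ commutator (SpecialLinearGroup n R) ≤
      (Subgroup.center (SpecialLinearGroup n F)).comap (SpecialLinearGroup.map f) := by
  intro hle
  obtain ⟨i, j, hij⟩ := exists_pair_ne n
  let g : SpecialLinearGroup n R := ⁅transvection hij (1 : R), transvection hij.symm (1 : R)⁆
  have hgj : g • (Pi.single j 1 : n → R) = -Pi.single i 1 := by
    simp only [g, commutatorElement_def, transvection_inv, mul_smul, transvection_smul, smul_add,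
      Pi.single_eq_of_ne hij, Pi.single_eq_of_ne hij.symm, Pi.single_eq_same, Pi.single_neg,
      Pi.single_zero, Pi.neg_apply, mul_zero, mul_one, one_mul, add_zero]
    abel
  have hg : g i j = -1 := by
    simpa [smul_single_one] using congrFun hgj i
  have hmem : g ∈ commutator (SpecialLinearGroup n R) :=
    Subgroup.commutator_mem_commutator (Subgroup.mem_top _) (Subgroup.mem_top _)
  have hzero := map_apply_eq_zero_of_mem_comap_center f (hle hmem) hij
  rw [hg, map_neg, map_one] at hzero
  exact neg_ne_zero.2 one_ne_zero hzero

variable [IsLocalHom f] {H : Subgroup (SpecialLinearGroup n R)} [H.Normal]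

theorem exists_mem_isUnit_apply
    (hH : ¬ H ≤ (Subgroup.center (SpecialLinearGroup n F)).comap (SpecialLinearGroup.map f)) :
    ∃ h ∈ H, ∃ i j, i ≠ j ∧ IsUnit (h i j) := by
  obtain ⟨h, hh, hcenter⟩ := SetLike.not_le_iff_exists.1 hH
  suffices ∃ h ∈ H, ∃ i j, i ≠ j ∧ f (h i j) ≠ 0 by
    obtain ⟨h, hh, i, j, hij, hf⟩ := this
    exact ⟨h, hh, i, j, hij, isUnit_of_map_unit f _ (IsUnit.mk0 _ hf)⟩
  by_contra! hoff
  obtain ⟨i, j, hne⟩ := exists_apply_self_ne_of_notMem_center hcenter fun i j ↦ hoff h hh i j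
  have hij : i ≠ j := fun hij ↦ hne (hij ▸ rfl)
  have hconj := hoff _ (Subgroup.Normal.conj_mem inferInstance h hh (transvection hij 1)) i j hij
  simp only [conj_transvection_apply, map_sub, map_add, one_mul, hoff h hh i j hij,
    hoff h hh j i hij.symm, zero_add, add_zero, sub_eq_zero] at hconj
  exact hne hconj.symm

theorem eq_top_of_not_le_comap_center
    (hR : Fintype.card n = 2 → ∃ u : R, IsUnit u ∧ IsUnit (u ^ 2 - 1))
    (hH : ¬ H ≤ (Subgroup.center (SpecialLinearGroup n F)).comap (SpecialLinearGroup.map f)) :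
    H = ⊤ := by
  have := RingHom.domain_isLocalRing f
  obtain ⟨h, hh, i, j, hij, hu⟩ := exists_mem_isUnit_apply f hH
  exact eq_top_of_mem_of_isUnit_apply hR hh hij hu

end Reduction

theorem lemma7p1_general [Nontrivial n] {F : Type*} [Field F] (f : R →+* F) [IsLocalHom f]
    (hR : Fintype.card n = 2 → ∃ u : R, IsUnit u ∧ IsUnit (u ^ 2 - 1)) :
    commutator (SpecialLinearGroup n R) = ⊤ ∧
    ∀ N' : Subgroup (SpecialLinearGroup n R),
      (∃ _ : N'.Normal, IsSimpleGroup (SpecialLinearGroup n R ⧸ N')) ↔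
      N' = (Subgroup.center (SpecialLinearGroup n F)).comap (SpecialLinearGroup.map f) := by
  have hcomm := not_commutator_le_comap_center (n := n) f
  refine ⟨eq_top_of_not_le_comap_center f hR hcomm,
    normal_and_isSimpleGroup_quotient_iff_eq inferInstance (fun htop ↦ hcomm (htop ▸ le_top)) ?_⟩
  exact fun H _ ↦ eq_top_of_not_le_comap_center f hR

end SpecialLinear

/-! ### The completion of `k[T]` at `𝔩` -/

section Completion

variable {k : Type*} [Field k] (𝔩 : HeightOneSpectrum k[X])

theorem isLocalHom_redMod : IsLocalHom (redMod 𝔩) := by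
  have hfg := IsNoetherian.noetherian 𝔩.asIdeal
  have := 𝔩.isMaximal
  have := AdicCompletion.isAdicComplete_self 𝔩.asIdeal hfg
  have := AdicCompletion.isMaximal_map_of_le 𝔩.asIdeal 𝔩.asIdeal le_rfl hfg
  have := isLocalRing_of_isAdicComplete_maximal
    (𝔩.asIdeal.map (algebraMap k[X] (CompletionAt 𝔩)))
  exact IsLocalHom.of_surjective _ (AdicCompletion.evalOneₐ_surjective 𝔩.asIdeal)

theorem scalarModSubgroup_eq_comap_center (r : ℕ) :
    scalarModSubgroup r 𝔩 =
      (Subgroup.center (Matrix.SpecialLinearGroup (Fin r) (ResidueFieldAt 𝔩))).comap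
        (Matrix.SpecialLinearGroup.map (redMod 𝔩)) := by
  ext B
  rw [Subgroup.mem_comap, Matrix.SpecialLinearGroup.mem_center_iff, Fintype.card_fin]
  simp only [Matrix.scalar_apply, ← Matrix.smul_one_eq_diagonal]
  exact exists_congr fun δ ↦ and_congr_right' eq_comm

theorem isUnit_natCast_of_lt_charP (p : ℕ) [CharP k p] {A : Type*} [Ring A] [Algebra k A]
    {m : ℕ} (hm : 0 < m) (hmp : m < p) : IsUnit (m : A) := by
  have hne : (m : k) ≠ 0 := fun h ↦
    Nat.not_dvd_of_pos_of_lt hm hmp ((CharP.cast_eq_zero_iff k p m).1 h)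
  simpa only [map_natCast] using (IsUnit.mk0 _ hne).map (algebraMap k A)

end Completion

theorem lemma7p1 (p : ℕ) [Fact p.Prime] (hp : 5 ≤ p)
    (k : Type*) [Field k] [Finite k] [CharP k p]
    (r : ℕ) (hr : r.Prime) (𝔩 : HeightOneSpectrum k[X]) :
    commutator (Matrix.SpecialLinearGroup (Fin r) (CompletionAt 𝔩)) = ⊤ ∧
    ∀ N' : Subgroup (Matrix.SpecialLinearGroup (Fin r) (CompletionAt 𝔩)),
      (∃ _ : N'.Normal,
        IsSimpleGroup (Matrix.SpecialLinearGroup (Fin r) (CompletionAt 𝔩) ⧸ N')) ↔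
      N' = scalarModSubgroup r 𝔩 := by
  have := 𝔩.isMaximal
  let _ : Field (ResidueFieldAt 𝔩) := Ideal.Quotient.field 𝔩.asIdeal
  have := isLocalHom_redMod 𝔩
  have : Nontrivial (Fin r) := Fin.nontrivial_iff_two_le.2 hr.two_le
  have hunit {m : ℕ} : 0 < m → m < p → IsUnit (m : CompletionAt 𝔩) :=
    isUnit_natCast_of_lt_charP (k := k) p
  rw [scalarModSubgroup_eq_comap_center]
  refine lemma7p1_general (redMod 𝔩) fun _ ↦ ⟨(2 : ℕ), hunit two_pos (by lia), ?_⟩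
  convert hunit (m := 3) three_pos (by lia) using 1
  norm_num
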